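/- Let $N\ge 1$ be an integer and $\sigma>0$ a real number, and let $\mathbf{A}$ be the discrete Laplacian on $\mathbb{Z}^N$, $(\mathbf{A}\psi)_n=\sum_{j=1}^N(\psi_{n-e_j}+\psi_{n+e_j})-2N\psi_n$, where $e_1,\dots,e_N$ are the standard unit vectors. Let $\gamma=(\gamma_n)_{n\in\mathbb{Z}^N}$ be a sequence of real numbers such that $\gamma_n>0$ for all $n$ in some nonempty set $\mathbf{S}_+\subseteq\mathbb{Z}^N$, and such that $(|\gamma_n|)_{n\in\mathbb{Z}^N}\in\ell^\rho$, i.e. $\sum_{n\in\mathbb{Z}^N}|\gamma_n|^\rho<\infty$, with $\rho=\frac{q-1}{q-2}$ for some real number $q>2$. Then for every $\omega>0$ there exists a nonzero $\phi=(\phi_n)_{n\in\mathbb{Z}^N}\in\ell^2(\mathbb{Z}^N;\mathbb{C})$ such that $\psi_n(t)=\phi_n e^{i\omega t}$ is a solution (a nontrivial breather solution) of the DNLS equation $$i\dot\psi_n(t)+(\mathbf{A}\psi(t))_n+\gamma_n|\psi_n(t)|^{2\sigma}\psi_n(t)=0,\qquad n\in\mathbb{Z}^N,\ t\in\mathbb{R}.$$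 -/

import Mathlib

/-- The discrete Laplacian on the lattice `ℤ^N`:
`(A ψ)_n = ∑_j (ψ_{n - e_j} + ψ_{n + e_j}) - 2 N ψ_n`. -/
noncomputable def discreteLaplacian {N : ℕ} (ψ : (Fin N → ℤ) → ℂ) (n : Fin N → ℤ) : ℂ :=
  (∑ j : Fin N, (ψ (n - Pi.single j 1) + ψ (n + Pi.single j 1))) - 2 * (N : ℂ) * ψ n

/-- `ψ` (with `ψ t n` the amplitude at time `t` and site `n`) solves, for all times, the DNLS equation
`i ψ'_n + (A ψ)_n + γ_n |ψ_n|^{2σ} ψ_n = 0` at every site. -/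
def IsDNLSSolution {N : ℕ} (σ : ℝ) (γ : (Fin N → ℤ) → ℝ) (ψ : ℝ → (Fin N → ℤ) → ℂ) : Prop :=
  ∀ (n : Fin N → ℤ) (t : ℝ),
    DifferentiableAt ℝ (fun s : ℝ => ψ s n) t ∧
      Complex.I * deriv (fun s : ℝ => ψ s n) t + discreteLaplacian (ψ t) n
        + (γ n : ℂ) * ((‖ψ t n‖ ^ (2 * σ) : ℝ) : ℂ) * ψ t n = 0

/-- The breather ansatz `ψ_n(t) = φ_n exp(i ω t)`. -/
noncomputable def breather {N : ℕ} (ω : ℝ) (φ : (Fin N → ℤ) → ℂ) : ℝ → (Fin N → ℤ) → ℂ :=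
  fun t n => φ n * Complex.exp (Complex.I * (ω : ℂ) * (t : ℂ))

open Filter Topology

section Lattice

variable {N : ℕ}

/-! The profile is a rescaled constrained maximizer. Write E for the sum of `energyDensity`, the
quadratic form of ω - A, and G for the sum of `powerDensity`. The set E ≤ 1 is compact for pointwise
convergence (`isCompact_energyBall`), and G is continuous on it because γ tends to zero at infinity
(`continuousOn_tsum_powerDensity`); the ℓ^ρ hypothesis enters only through this decay. So G attains
a maximum M, and M > 0 since γ is positive somewhere.

Homogeneity turns the maximum into G ≤ M E^(σ+1), with equality at the maximizer, where E = 1.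
Varying one site at a time gives γ|φ|^(2σ)φ = M(ω - A)φ (`eulerLagrange`), and scaling φ removes M.
-/

/-- Pointwise density of the quadratic form of `ω - A`. -/
noncomputable def energyDensity (ω : ℝ) (φ : (Fin N → ℤ) → ℝ) (n : Fin N → ℤ) : ℝ :=
  ω * φ n ^ 2 + ∑ j : Fin N, (φ (n + Pi.single j 1) - φ n) ^ 2

/-- The polar form of `energyDensity`. -/
noncomputable def energyPolar (ω : ℝ) (φ η : (Fin N → ℤ) → ℝ) (n : Fin N → ℤ) : ℝ :=
  ω * (φ n * η n) +
    ∑ j : Fin N, (φ (n + Pi.single j 1) - φ n) * (η (n + Pi.single j 1) - η n)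

/-- The operator `ω - A` on real sequences. -/
noncomputable def shiftedLaplacian (ω : ℝ) (φ : (Fin N → ℤ) → ℝ) (n : Fin N → ℤ) : ℝ :=
  ω * φ n + ∑ j : Fin N, (2 * φ n - φ (n - Pi.single j 1) - φ (n + Pi.single j 1))

/-- Sequences of energy at most one. -/
def energyBall (N : ℕ) (ω : ℝ) : Set ((Fin N → ℤ) → ℝ) :=
  {φ | ∀ F : Finset (Fin N → ℤ), ∑ n ∈ F, energyDensity ω φ n ≤ 1}

/-- Density of the nonlinear part of the Hamiltonian. -/
noncomputable def powerDensity (σ : ℝ) (γ φ : (Fin N → ℤ) → ℝ) (n : Fin N → ℤ) : ℝ :=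
  γ n * |φ n| ^ (2 * σ + 2)

lemma energyDensity_nonneg {ω : ℝ} (hω : 0 < ω) (φ : (Fin N → ℤ) → ℝ) (n : Fin N → ℤ) :
    0 ≤ energyDensity ω φ n := by
  unfold energyDensity
  have := Finset.sum_nonneg (fun (j : Fin N) (_ : j ∈ Finset.univ) =>
    sq_nonneg (φ (n + Pi.single j 1) - φ n))
  positivity

lemma mul_sq_le_energyDensity (ω : ℝ) (φ : (Fin N → ℤ) → ℝ) (n : Fin N → ℤ) :
    ω * φ n ^ 2 ≤ energyDensity ω φ n := by
  unfold energyDensity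
  have := Finset.sum_nonneg (fun (j : Fin N) (_ : j ∈ Finset.univ) =>
    sq_nonneg (φ (n + Pi.single j 1) - φ n))
  linarith

lemma energyDensity_add_smul (ω s : ℝ) (φ η : (Fin N → ℤ) → ℝ) (n : Fin N → ℤ) :
    energyDensity ω (φ + s • η) n =
      energyDensity ω φ n + 2 * s * energyPolar ω φ η n + s ^ 2 * energyDensity ω η n := by
  simp only [energyDensity, energyPolar, mul_add, Finset.mul_sum, Pi.add_apply, Pi.smul_apply,
    smul_eq_mul]
  have : ∀ j : Fin N, (φ (n + Pi.single j 1) + s * η (n + Pi.single j 1) - (φ n + s * η n)) ^ 2 =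
      (φ (n + Pi.single j 1) - φ n) ^ 2 +
      2 * s * ((φ (n + Pi.single j 1) - φ n) * (η (n + Pi.single j 1) - η n)) +
      s ^ 2 * (η (n + Pi.single j 1) - η n) ^ 2 := fun j => by ring
  simp only [this, Finset.sum_add_distrib]
  ring

lemma energyDensity_smul (ω s : ℝ) (φ : (Fin N → ℤ) → ℝ) (n : Fin N → ℤ) :
    energyDensity ω (s • φ) n = s ^ 2 * energyDensity ω φ n := by
  simp only [energyDensity, mul_add, Finset.mul_sum, Pi.smul_apply, smul_eq_mul]
  congr 1
  · ring
  · exact Finset.sum_congr rfl fun j _ => by ring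

/-- Summation by parts against a delta: only the sites m and m - e_j contribute, so φ needs no
decay. -/
lemma hasSum_energyPolar_single (ω : ℝ) (φ : (Fin N → ℤ) → ℝ) (m : Fin N → ℤ) :
    HasSum (energyPolar ω φ (Pi.single m 1)) (shiftedLaplacian ω φ m) := by
  unfold energyPolar shiftedLaplacian
  refine HasSum.add ?_ (hasSum_sum fun j _ => ?_)
  · convert hasSum_single m (f := fun n => ω * (φ n * (Pi.single m 1 : (Fin N → ℤ) → ℝ) n)) ?_
      using 1
    · simp
    · intro n hn
      simp [hn]
  · have h1 : HasSum (fun n => (φ (n + Pi.single j 1) - φ n) *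
        (Pi.single m 1 : (Fin N → ℤ) → ℝ) (n + Pi.single j 1)) (φ m - φ (m - Pi.single j 1)) := by
      convert hasSum_single (m - Pi.single j 1) (f := fun n => (φ (n + Pi.single j 1) - φ n) *
        (Pi.single m 1 : (Fin N → ℤ) → ℝ) (n + Pi.single j 1)) ?_ using 1
      · simp
      · intro n hn
        have : n + Pi.single j 1 ≠ m := fun h => hn (eq_sub_of_add_eq h)
        simp [this]
    have h2 : HasSum (fun n => (φ (n + Pi.single j 1) - φ n) *
        (Pi.single m 1 : (Fin N → ℤ) → ℝ) n) (φ (m + Pi.single j 1) - φ m) := by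
      convert hasSum_single m (f := fun n => (φ (n + Pi.single j 1) - φ n) *
        (Pi.single m 1 : (Fin N → ℤ) → ℝ) n) ?_ using 1
      · simp
      · intro n hn
        simp [hn]
    have h3 := h1.sub h2
    simp only [← mul_sub] at h3
    rwa [show 2 * φ m - φ (m - Pi.single j 1) - φ (m + Pi.single j 1) =
      φ m - φ (m - Pi.single j 1) - (φ (m + Pi.single j 1) - φ m) by ring]

lemma summable_energyDensity_single (ω : ℝ) (m : Fin N → ℤ) :
    Summable (energyDensity ω (Pi.single m 1 : (Fin N → ℤ) → ℝ)) := by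
  refine (hasSum_energyPolar_single ω (Pi.single m 1) m).summable.congr fun n => ?_
  simp only [energyDensity, energyPolar, sq]

lemma mem_energyBall_iff {ω : ℝ} (hω : 0 < ω) {φ : (Fin N → ℤ) → ℝ} :
    φ ∈ energyBall N ω ↔ Summable (energyDensity ω φ) ∧ ∑' n, energyDensity ω φ n ≤ 1 :=
  ⟨fun h => ⟨summable_of_sum_le (energyDensity_nonneg hω φ) h,
      Real.tsum_le_of_sum_le (energyDensity_nonneg hω φ) h⟩,
    fun h F => (h.1.sum_le_tsum F fun n _ => energyDensity_nonneg hω φ n).trans h.2⟩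

lemma abs_le_of_mem_energyBall {ω : ℝ} (hω : 0 < ω) {φ : (Fin N → ℤ) → ℝ}
    (h : φ ∈ energyBall N ω) (n : Fin N → ℤ) : |φ n| ≤ √(1 / ω) := by
  apply Real.abs_le_sqrt
  have h1 := h {n}
  rw [Finset.sum_singleton] at h1
  rw [le_div_iff₀ hω]
  linarith [mul_sq_le_energyDensity ω φ n]

/-- Tychonoff. Bounding finite partial sums makes the ball an intersection of closed conditions,
each on finitely many coordinates. -/
lemma isCompact_energyBall {ω : ℝ} (hω : 0 < ω) : IsCompact (energyBall N ω) := by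
  have hcl : IsClosed (energyBall N ω) := by
    simp only [energyBall, Set.ofPred_forall, energyDensity]
    exact isClosed_iInter fun F => isClosed_le (by fun_prop) continuous_const
  refine (isCompact_univ_pi fun _ : Fin N → ℤ =>
    isCompact_Icc (a := -√(1 / ω)) (b := √(1 / ω))).of_isClosed_subset hcl ?_
  intro φ h n _
  exact abs_le.mp (abs_le_of_mem_energyBall hω h n)

lemma abs_powerDensity_le {σ ω : ℝ} (hσ : 0 < σ) (hω : 0 < ω) (γ : (Fin N → ℤ) → ℝ)
    {φ : (Fin N → ℤ) → ℝ} {B : ℝ} (n : Fin N → ℤ) (hB : |φ n| ≤ B) :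
    |powerDensity σ γ φ n| ≤ |γ n| * (B ^ (2 * σ) / ω * energyDensity ω φ n) := by
  have hB0 : 0 ≤ B := (abs_nonneg _).trans hB
  rw [powerDensity, abs_mul, abs_of_nonneg (Real.rpow_nonneg (abs_nonneg (φ n)) _)]
  gcongr
  rw [Real.rpow_add_of_nonneg (abs_nonneg _) (by positivity) (by norm_num), Real.rpow_two, sq_abs,
    div_mul_eq_mul_div, mul_div_assoc]
  gcongr
  rw [le_div_iff₀ hω, mul_comm]
  exact mul_sq_le_energyDensity ω φ n

lemma summable_powerDensity {σ ω : ℝ} (hσ : 0 < σ) (hω : 0 < ω) {γ : (Fin N → ℤ) → ℝ}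
    (hγ : Tendsto γ cofinite (𝓝 0)) {φ : (Fin N → ℤ) → ℝ} {B : ℝ} (hB : ∀ n, |φ n| ≤ B)
    (h : Summable (energyDensity ω φ)) : Summable (powerDensity σ γ φ) := by
  refine Summable.of_norm_bounded_eventually (h.mul_left (B ^ (2 * σ) / ω)) ?_
  have h1 : ∀ᶠ n in cofinite, |γ n| < 1 := by
    simpa using Metric.tendsto_nhds.mp hγ 1 one_pos
  filter_upwards [h1] with n hn
  have hB0 : 0 ≤ B := (abs_nonneg _).trans (hB n)
  have he := energyDensity_nonneg hω φ n
  exact (abs_powerDensity_le hσ hω γ n (hB n)).trans (mul_le_of_le_one_left (by positivity) hn.le)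

/-- Finite partial sums converge uniformly on the ball: off the finite set where |γ| ≥ ε/(2C), the
tail is at most ε/2 times the energy. -/
lemma continuousOn_tsum_powerDensity {σ ω : ℝ} (hσ : 0 < σ) (hω : 0 < ω)
    {γ : (Fin N → ℤ) → ℝ} (hγ : Tendsto γ cofinite (𝓝 0)) :
    ContinuousOn (fun φ => ∑' n, powerDensity σ γ φ n) (energyBall N ω) := by
  have hu : TendstoUniformlyOn (fun (F : Finset (Fin N → ℤ)) φ => ∑ n ∈ F, powerDensity σ γ φ n)
      (fun φ => ∑' n, powerDensity σ γ φ n) atTop (energyBall N ω) := by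
    rw [Metric.tendstoUniformlyOn_iff]
    intro ε hε
    set C : ℝ := √(1 / ω) ^ (2 * σ) / ω with hC
    have hC0 : 0 < C := by positivity
    have hfin : ∀ᶠ n in cofinite, |γ n| < ε / (2 * C) := by
      simpa using Metric.tendsto_nhds.mp hγ (ε / (2 * C)) (by positivity)
    filter_upwards [eventually_ge_atTop (Set.Finite.toFinset hfin)] with F hF φ hφ
    obtain ⟨hs, hle⟩ := (mem_energyBall_iff hω).mp hφ
    have hsum := summable_powerDensity hσ hω hγ (abs_le_of_mem_energyBall hω hφ) hs
    rw [Real.dist_eq, ← hsum.sum_add_tsum_compl (s := F), add_sub_cancel_left]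
    have hs' : Summable fun n : ((F : Set (Fin N → ℤ))ᶜ : Set _) =>
        ε / (2 * C) * (C * energyDensity ω φ n) :=
      ((hs.mul_left C).mul_left (ε / (2 * C))).subtype _
    have hb : |∑' n : ((F : Set (Fin N → ℤ))ᶜ : Set _), powerDensity σ γ φ n| ≤
        ∑' n : ((F : Set (Fin N → ℤ))ᶜ : Set _), ε / (2 * C) * (C * energyDensity ω φ n) := by
      rw [← Real.norm_eq_abs]
      refine tsum_of_norm_bounded hs'.hasSum fun n => ?_
      rw [Real.norm_eq_abs]
      have hn : |γ n| < ε / (2 * C) := by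
        by_contra hcon
        exact n.2 (hF ((Set.Finite.mem_toFinset hfin).mpr hcon))
      refine (abs_powerDensity_le hσ hω γ _ (abs_le_of_mem_energyBall hω hφ n)).trans ?_
      have he := energyDensity_nonneg hω φ n
      gcongr
    have ht : ∑' n : ((F : Set (Fin N → ℤ))ᶜ : Set _), ε / (2 * C) * (C * energyDensity ω φ n) ≤
        ∑' n, ε / (2 * C) * (C * energyDensity ω φ n) := by
      refine ((hs.mul_left C).mul_left (ε / (2 * C))).tsum_subtype_le _ _ fun n => ?_
      have he := energyDensity_nonneg hω φ n
      positivity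
    have ht' : ∑' n, ε / (2 * C) * (C * energyDensity ω φ n) =
        ε / (2 * C) * (C * ∑' n, energyDensity ω φ n) := by
      rw [tsum_mul_left, tsum_mul_left]
    have h3 : ε / (2 * C) * (C * ∑' n, energyDensity ω φ n) ≤ ε / (2 * C) * (C * 1) := by
      gcongr
    have h4 : ε / (2 * C) * (C * 1) = ε / 2 := by
      field_simp
    exact (hb.trans (ht.trans (ht'.trans_le (h3.trans_eq h4)))).trans_lt (half_lt_self hε)
  refine hu.continuousOn (Frequently.of_forall fun F => Continuous.continuousOn ?_)
  refine continuous_finsetSum _ fun n _ => continuous_const.mul ?_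
  exact (continuous_apply n).abs.rpow_const fun _ => Or.inr (by positivity)

lemma powerDensity_smul {σ s : ℝ} (hs : 0 ≤ s) (γ φ : (Fin N → ℤ) → ℝ) (n : Fin N → ℤ) :
    powerDensity σ γ (s • φ) n = s ^ (2 * σ + 2) * powerDensity σ γ φ n := by
  simp only [powerDensity, Pi.smul_apply, smul_eq_mul]
  rw [abs_mul, abs_of_nonneg hs, Real.mul_rpow hs (abs_nonneg _)]
  ring

/-- By homogeneity, a bound on the unit energy ball gives a global bound. -/
lemma tsum_powerDensity_le {σ ω M : ℝ} (hω : 0 < ω) {γ : (Fin N → ℤ) → ℝ}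
    (hM : ∀ φ ∈ energyBall N ω, ∑' n, powerDensity σ γ φ n ≤ M) {φ : (Fin N → ℤ) → ℝ}
    (hs : Summable (energyDensity ω φ)) (hE : 0 < ∑' n, energyDensity ω φ n) :
    ∑' n, powerDensity σ γ φ n ≤ M * (∑' n, energyDensity ω φ n) ^ (σ + 1) := by
  set E := ∑' n, energyDensity ω φ n
  have h0 : 0 ≤ (√E)⁻¹ := by positivity
  have hmem : (√E)⁻¹ • φ ∈ energyBall N ω := by
    rw [mem_energyBall_iff hω]
    simp only [funext (energyDensity_smul ω (√E)⁻¹ φ), inv_pow, Real.sq_sqrt hE.le]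
    refine ⟨hs.mul_left _, ?_⟩
    rw [tsum_mul_left, inv_mul_cancel₀ hE.ne']
  have h := hM _ hmem
  simp only [powerDensity_smul h0, tsum_mul_left] at h
  have hp : (√E)⁻¹ ^ (2 * σ + 2) = (E ^ (σ + 1))⁻¹ := by
    rw [Real.inv_rpow (Real.sqrt_nonneg _), Real.sqrt_eq_rpow, ← Real.rpow_mul hE.le]
    congr 2
    ring
  rw [hp, inv_mul_eq_div, div_le_iff₀ (by positivity)] at h
  exact h

/-- The Euler-Lagrange equation of a normalized maximizer. -/
lemma eulerLagrange {σ ω M : ℝ} (hσ : 0 < σ) (hω : 0 < ω)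
    {γ φ : (Fin N → ℤ) → ℝ} (hs : Summable (energyDensity ω φ))
    (hE : ∑' n, energyDensity ω φ n = 1) (hg : Summable (powerDensity σ γ φ))
    (hG : ∑' n, powerDensity σ γ φ n = M)
    (hM : ∀ ψ ∈ energyBall N ω, ∑' n, powerDensity σ γ ψ n ≤ M) (m : Fin N → ℤ) :
    γ m * |φ m| ^ (2 * σ) * φ m = M * shiftedLaplacian ω φ m := by
  set η : (Fin N → ℤ) → ℝ := Pi.single m 1 with hη
  set L := shiftedLaplacian ω φ m
  set Q := ∑' n, energyDensity ω η n
  have hpol := hasSum_energyPolar_single ω φ m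
  have hQ := (summable_energyDensity_single ω m).hasSum
  have hES (s : ℝ) : HasSum (energyDensity ω (φ + s • η)) (1 + 2 * s * L + s ^ 2 * Q) := by
    rw [funext (energyDensity_add_smul ω s φ η), ← hE]
    exact (hs.hasSum.add (hpol.mul_left _)).add (hQ.mul_left _)
  have hGS (s : ℝ) : HasSum (powerDensity σ γ (φ + s • η))
      (M + (γ m * |φ m + s| ^ (2 * σ + 2) - γ m * |φ m| ^ (2 * σ + 2))) := by
    have h1 : HasSum (fun n => powerDensity σ γ (φ + s • η) n - powerDensity σ γ φ n)
        (powerDensity σ γ (φ + s • η) m - powerDensity σ γ φ m) := by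
      refine hasSum_single m fun n hn => ?_
      simp [powerDensity, hη, hn]
    have h2 := hg.hasSum.add h1
    rw [hG] at h2
    simp only [add_sub_cancel] at h2
    have hv : powerDensity σ γ (φ + s • η) m - powerDensity σ γ φ m =
        γ m * |φ m + s| ^ (2 * σ + 2) - γ m * |φ m| ^ (2 * σ + 2) := by
      simp [powerDensity, hη]
    rwa [hv] at h2
  -- The gap M E^(σ+1) - G along φ + sη is nonnegative near s = 0 and vanishes there, so no Lagrange
  -- multiplier is needed.
  let f : ℝ → ℝ := fun s => M * (1 + 2 * s * L + s ^ 2 * Q) ^ (σ + 1) -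
    (M + (γ m * |φ m + s| ^ (2 * σ + 2) - γ m * |φ m| ^ (2 * σ + 2)))
  have hmin : IsLocalMin f 0 := by
    have hc : ContinuousAt (fun s : ℝ => 1 + 2 * s * L + s ^ 2 * Q) 0 := by fun_prop
    have hpos : ∀ᶠ s : ℝ in 𝓝 0, 0 < 1 + 2 * s * L + s ^ 2 * Q :=
      hc.eventually (lt_mem_nhds (by simp))
    filter_upwards [hpos] with s hs'
    have h := tsum_powerDensity_le (σ := σ) hω hM (hES s).summable (by rwa [(hES s).tsum_eq])
    rw [(hES s).tsum_eq, (hGS s).tsum_eq] at h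
    simp only [f, mul_zero, zero_mul, add_zero, ne_eq, OfNat.ofNat_ne_zero, not_false_eq_true,
      zero_pow, Real.one_rpow, mul_one, sub_self]
    linarith
  have hd1 : HasDerivAt (fun s : ℝ => 1 + 2 * s * L + s ^ 2 * Q) (2 * L) 0 := by
    have := ((((hasDerivAt_id (0 : ℝ)).const_mul 2).mul_const L).const_add 1).add
      (((hasDerivAt_id (0 : ℝ)).pow 2).mul_const Q)
    exact this.congr_deriv (by simp)
  have hd2 := (hd1.rpow_const (p := σ + 1) (Or.inl (by simp))).const_mul M
  have hd3 : HasDerivAt (fun s : ℝ => |φ m + s| ^ (2 * σ + 2))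
      ((2 * σ + 2) * |φ m| ^ (2 * σ + 2 - 2) * φ m) 0 := by
    have h := hasDerivAt_abs_rpow (φ m + 0) (p := 2 * σ + 2) (by linarith)
    simpa using h.comp_const_add (φ m) 0
  have hf := hmin.hasDerivAt_eq_zero
    (hd2.sub (((hd3.const_mul (γ m)).sub_const _).const_add M))
  simp only [mul_zero, zero_mul, add_zero, ne_eq, OfNat.ofNat_ne_zero, not_false_eq_true,
    zero_pow, Real.one_rpow, mul_one, add_sub_cancel_right] at hf
  have : (2 * σ + 2) * (γ m * |φ m| ^ (2 * σ) * φ m - M * L) = 0 := by linarith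
  rcases mul_eq_zero.mp this with h | h
  · linarith
  · linarith

lemma exists_maximizer {σ ω : ℝ} (hσ : 0 < σ) (hω : 0 < ω) {γ : (Fin N → ℤ) → ℝ}
    (hγ : Tendsto γ cofinite (𝓝 0)) {m : Fin N → ℤ} (hm : 0 < γ m) :
    ∃ φ : (Fin N → ℤ) → ℝ, ∃ M : ℝ, 0 < M ∧ φ ∈ energyBall N ω ∧
      ∑' n, energyDensity ω φ n = 1 ∧ ∑' n, powerDensity σ γ φ n = M ∧
      ∀ ψ ∈ energyBall N ω, ∑' n, powerDensity σ γ ψ n ≤ M := by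
  have hne : (energyBall N ω).Nonempty := ⟨0, fun F => by simp [energyDensity]⟩
  obtain ⟨φ, hφ, hmax⟩ := (isCompact_energyBall hω).exists_isMaxOn hne
    (continuousOn_tsum_powerDensity hσ hω hγ)
  have hM : ∀ ψ ∈ energyBall N ω,
      ∑' n, powerDensity σ γ ψ n ≤ ∑' n, powerDensity σ γ φ n := fun ψ hψ => hmax hψ
  set M := ∑' n, powerDensity σ γ φ n with hMdef
  have hMpos : 0 < M := by
    -- Test the homogeneous bound on a delta at m, where G equals γ m > 0.
    set η : (Fin N → ℤ) → ℝ := Pi.single m 1 with hη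
    have hsη := summable_energyDensity_single ω m
    have hE : 0 < ∑' n, energyDensity ω η n := by
      refine hsη.tsum_pos (energyDensity_nonneg hω η) m ?_
      refine lt_of_lt_of_le ?_ (mul_sq_le_energyDensity ω η m)
      simpa [hη] using hω
    have h := tsum_powerDensity_le (σ := σ) hω hM hsη hE
    have hG : ∑' n, powerDensity σ γ η n = γ m := by
      rw [tsum_eq_single m]
      · simp [powerDensity, hη]
      · intro n hn
        have : 2 * σ + 2 ≠ 0 := by positivity
        simp [powerDensity, hη, hn, Real.zero_rpow this]
    change ∑' n, powerDensity σ γ η n ≤ _ at h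
    rw [hG] at h
    exact pos_of_mul_pos_left (hm.trans_le h) (by positivity)
  obtain ⟨hs, hle⟩ := (mem_energyBall_iff hω).mp hφ
  refine ⟨φ, M, hMpos, hφ, le_antisymm hle ?_, rfl, hM⟩
  have hE0 : 0 < ∑' n, energyDensity ω φ n := by
    refine (tsum_nonneg (energyDensity_nonneg hω φ)).lt_of_ne fun h0 => hMpos.ne' ?_
    have hz (n) : φ n = 0 := by
      have h1 := hs.le_tsum n fun k _ => energyDensity_nonneg hω φ k
      have h2 := mul_sq_le_energyDensity ω φ n
      have h3 : φ n ^ 2 ≤ 0 := by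
        by_contra hcon
        have := mul_pos hω (not_le.mp hcon)
        linarith
      exact pow_eq_zero_iff two_ne_zero |>.mp (le_antisymm h3 (sq_nonneg _))
    have h2 : 2 * σ + 2 ≠ 0 := by positivity
    simp [hMdef, powerDensity, hz, Real.zero_rpow h2]
  have h := tsum_powerDensity_le (σ := σ) hω hM hs hE0
  -- If E < 1, then M ≤ M E^(σ+1) < M.
  by_contra hcon
  have hlt := Real.rpow_lt_one hE0.le (not_le.mp hcon) (by positivity : 0 < σ + 1)
  have := mul_lt_mul_of_pos_left hlt hMpos
  rw [← hMdef] at h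
  linarith

/-- Existence of a nonzero real square-summable solution of the stationary equation. -/
lemma exists_stationary {σ ω : ℝ} (hσ : 0 < σ) (hω : 0 < ω) {γ : (Fin N → ℤ) → ℝ}
    (hγ : Tendsto γ cofinite (𝓝 0)) {m : Fin N → ℤ} (hm : 0 < γ m) :
    ∃ φ : (Fin N → ℤ) → ℝ, φ ≠ 0 ∧ Summable (fun n => φ n ^ 2) ∧
      ∀ n, γ n * |φ n| ^ (2 * σ) * φ n = shiftedLaplacian ω φ n := by
  obtain ⟨φ, M, hM, hφ, hE, hG, hmax⟩ := exists_maximizer hσ hω hγ hm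
  have hs := ((mem_energyBall_iff hω).mp hφ).1
  have hg := summable_powerDensity hσ hω hγ (abs_le_of_mem_energyBall hω hφ) hs
  have hEL := eulerLagrange hσ hω hs hE hg hG hmax
  -- Scaling by c multiplies the nonlinear side by c^(2σ+1) and the linear side by c, so c^(2σ) =
  -- 1/M cancels the multiplier.
  set c : ℝ := (M⁻¹) ^ (2 * σ)⁻¹ with hc
  have hc0 : 0 < c := by positivity
  have hcM : c ^ (2 * σ) = M⁻¹ := Real.rpow_inv_rpow (by positivity) (by positivity)
  refine ⟨c • φ, ?_, ?_, fun n => ?_⟩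
  · rw [smul_ne_zero_iff]
    refine ⟨hc0.ne', ?_⟩
    rintro rfl
    simp [energyDensity] at hE
  · have : Summable fun n => φ n ^ 2 := by
      refine Summable.of_nonneg_of_le (fun n => sq_nonneg _) (fun n => ?_) (hs.mul_left ω⁻¹)
      rw [inv_mul_eq_div, le_div_iff₀ hω, mul_comm]
      exact mul_sq_le_energyDensity ω φ n
    simpa [mul_pow] using this.mul_left (c ^ 2)
  · have hL : shiftedLaplacian ω (c • φ) n = c * shiftedLaplacian ω φ n := by
      simp only [shiftedLaplacian, Pi.smul_apply, smul_eq_mul, mul_add, Finset.mul_sum]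
      congr 1
      · ring
      · exact Finset.sum_congr rfl fun j _ => by ring
    rw [hL, Pi.smul_apply, smul_eq_mul, abs_mul, abs_of_pos hc0,
      Real.mul_rpow hc0.le (abs_nonneg _), hcM]
    calc γ n * (M⁻¹ * |φ n| ^ (2 * σ)) * (c * φ n)
        = M⁻¹ * c * (γ n * |φ n| ^ (2 * σ) * φ n) := by ring
      _ = c * shiftedLaplacian ω φ n := by
        rw [hEL n]
        field_simp

/-- A real solution of the stationary equation yields a breather. -/
lemma isDNLSSolution_breather {σ ω : ℝ} {γ φ : (Fin N → ℤ) → ℝ}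
    (h : ∀ n, γ n * |φ n| ^ (2 * σ) * φ n = shiftedLaplacian ω φ n) :
    IsDNLSSolution σ γ (breather ω fun n => (φ n : ℂ)) := by
  intro n t
  set e : ℂ := Complex.exp (Complex.I * ω * t) with he
  have hd : HasDerivAt (fun s : ℝ => breather ω (fun n => (φ n : ℂ)) s n)
      (φ n * (e * (Complex.I * ω))) t := by
    have h1 : HasDerivAt (fun s : ℝ => Complex.I * ω * (s : ℂ)) (Complex.I * ω) t := by
      simpa using Complex.ofRealCLM.hasDerivAt.const_mul (Complex.I * ω)
    exact h1.cexp.const_mul _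
  refine ⟨hd.differentiableAt, ?_⟩
  have hnorm : ‖breather ω (fun n => (φ n : ℂ)) t n‖ = |φ n| := by
    have : Complex.I * (ω : ℂ) * (t : ℂ) = ((ω * t : ℝ) : ℂ) * Complex.I := by
      push_cast
      ring
    rw [breather, norm_mul, this, Complex.norm_exp_ofReal_mul_I, mul_one, Complex.norm_real,
      Real.norm_eq_abs]
  have hA : discreteLaplacian (breather ω (fun n => (φ n : ℂ)) t) n =
      (ω * φ n - shiftedLaplacian ω φ n) * e := by
    simp only [discreteLaplacian, breather, shiftedLaplacian, ← he]
    push_cast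
    simp only [← add_mul, ← Finset.sum_mul, Finset.sum_sub_distrib, Finset.sum_add_distrib,
      Finset.sum_const, Finset.card_univ, Fintype.card_fin, nsmul_eq_mul]
    ring
  rw [hd.deriv, hnorm, hA, ← h n]
  simp only [breather, ← he]
  push_cast
  linear_combination (φ n * e * ω : ℂ) * Complex.I_sq

end Lattice

lemma Memℓp.tendsto_cofinite_zero {ι : Type*} {f : ι → ℝ} {r : ℝ} (hr : 0 < r)
    (hf : Memℓp f (ENNReal.ofReal r)) : Tendsto f cofinite (𝓝 0) := by
  have htr : (ENNReal.ofReal r).toReal = r := ENNReal.toReal_ofReal hr.le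
  have h := (hf.summable (by rwa [htr])).tendsto_cofinite_zero
  rw [htr] at h
  have h2 := h.rpow_const (p := r⁻¹) (Or.inr (by positivity))
  rw [Real.zero_rpow (by positivity)] at h2
  refine tendsto_zero_iff_norm_tendsto_zero.mpr (h2.congr fun n => ?_)
  exact Real.rpow_rpow_inv (norm_nonneg _) hr.ne'

theorem theorem2p3 (N : ℕ) (hN : 0 < N) (σ : ℝ) (hσ : 0 < σ) (γ : (Fin N → ℤ) → ℝ)
    (Splus : Set (Fin N → ℤ)) (hSne : Splus.Nonempty) (hpos : ∀ n ∈ Splus, 0 < γ n)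
    (q : ℝ) (hq : 2 < q)
    (hγ : Memℓp (fun n => |γ n|) (ENNReal.ofReal ((q - 1) / (q - 2)))) :
    ∀ ω : ℝ, 0 < ω →
      ∃ φ : (Fin N → ℤ) → ℂ, Memℓp φ 2 ∧ φ ≠ 0 ∧ IsDNLSSolution σ γ (breather ω φ) := by
  intro ω hω
  obtain ⟨m, hm⟩ := hSne
  have hr : 0 < (q - 1) / (q - 2) := div_pos (by linarith) (by linarith)
  have hγ0 : Tendsto γ cofinite (𝓝 0) :=
    (tendsto_zero_iff_abs_tendsto_zero _).mpr (hγ.tendsto_cofinite_zero hr)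
  obtain ⟨φ, hne, hs, hφ⟩ := exists_stationary hσ hω hγ0 (hpos m hm)
  refine ⟨fun n => (φ n : ℂ), ?_, ?_, isDNLSSolution_breather hφ⟩
  · refine memℓp_gen ?_
    simpa using hs
  · intro h
    refine hne (funext fun n => ?_)
    simpa using congrFun h n
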